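/- Let $K$ be a field of characteristic zero, let $n\ge 1$, and let $R=K[x_1,\dots,x_n]$ be the polynomial ring with its standard grading. Let $d_0,\dots,d_{n-1}$ be positive integers and let $a\in K$ with $a\neq 1$. Put $$I=\bigl(x_n^{d_0}(x_n-a x_1),\ x_i^{d_i}(x_i-x_{i+1})\ \big|\ 1\le i\le n-1\bigr)\subset R .$$ Then the graded algebra $A=R/I$ is an artinian complete intersection, that is, $A$ is artinian and $I$ is generated by a regular sequence of homogeneous polynomials. Moreover, $A$ has the strong Lefschetz property: there is a linear form $\ell\in A_1$ such that for all integers $k,s\ge 0$ the multiplication map $\times\ell^s: A_k\to A_{k+s}$ is injective or surjective. -/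

import Mathlib

/-- The degree `k` component of the standard graded algebra `K[x_σ] / I`: the image of the space of
forms of degree `k`. -/
noncomputable def gradedPiece {K σ : Type*} [Field K] (I : Ideal (MvPolynomial σ K)) (k : ℕ) :
    Submodule K (MvPolynomial σ K ⧸ I) :=
  (MvPolynomial.homogeneousSubmodule σ K k).map (Ideal.Quotient.mkₐ K I).toLinearMap

/-- The class `ℓ` of a linear form is a strong Lefschetz element of `A = K[x_σ] / I` if
multiplication by `ℓ ^ s` from `A_k` to `A_{k+s}` is injective or surjective, for all `k` and `s`. -/
def IsStrongLefschetzElement {K σ : Type*} [Field K] (I : Ideal (MvPolynomial σ K))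
    (l : MvPolynomial σ K ⧸ I) : Prop :=
  l ∈ gradedPiece I 1 ∧
    ∀ k s : ℕ, Set.InjOn (fun y => l ^ s * y) (gradedPiece I k) ∨
      Set.SurjOn (fun y => l ^ s * y) (gradedPiece I k) (gradedPiece I (k + s))

/-- The strong Lefschetz property of `K[x_σ] / I`. -/
def HasStrongLefschetzProperty {K σ : Type*} [Field K] (I : Ideal (MvPolynomial σ K)) : Prop :=
  ∃ l : MvPolynomial σ K ⧸ I, IsStrongLefschetzElement I l

/-- `K[x_σ] / I` is a (graded) complete intersection: `I` is generated by a regular sequence of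
homogeneous polynomials. -/
def IsGradedCompleteIntersection {K σ : Type*} [Field K] (I : Ideal (MvPolynomial σ K)) : Prop :=
  ∃ fs : List (MvPolynomial σ K), (∀ f ∈ fs, ∃ e : ℕ, f.IsHomogeneous e) ∧
    RingTheory.Sequence.IsRegular (MvPolynomial σ K) fs ∧ I = Ideal.ofList fs

/-- With `n = m + 1` variables `x_1, …, x_n` (here `X 0, …, X (Fin.last m)`), the ideal generated by
`x_n ^ d_0 * (x_n - a * x_1)` and `x_i ^ d_i * (x_i - x_{i+1})` for `1 ≤ i ≤ n - 1`. -/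
noncomputable def linearProductIdeal {K : Type*} [Field K] (m : ℕ) (d : Fin (m + 1) → ℕ) (a : K) :
    Ideal (MvPolynomial (Fin (m + 1)) K) :=
  Ideal.span
    (insert
      (MvPolynomial.X (Fin.last m) ^ d 0 *
        (MvPolynomial.X (Fin.last m) - MvPolynomial.C a * MvPolynomial.X 0))
      (Set.range fun i : Fin m =>
        MvPolynomial.X i.castSucc ^ d i.succ *
          (MvPolynomial.X i.castSucc - MvPolynomial.X i.succ)))

/-! The algebra `A = K[x_0, …, x_m] / I`, with generators `x_i ^ δ_i * (x_i - x_{i+1})` for `i < m`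
and `x_m ^ δ_m * (x_m - a * x_0)`, is compared with a monomial algebra. Put `D = ∑ δ_i`.

Upper bounds. Eliminating along the chain gives `x_0 ^ (δ_0 + ⋯ + δ_{i-1}) * (x_0 - x_i) = 0` in `A`
(`X_zero_pow_mul_sub_mem_chainIdeal`). For weights with `w_0 < w_m < ⋯ < w_1`, these relations and
the generators turn each monomial divisible by `x_0 ^ (δ_0 + ⋯ + δ_{i-1}) * x_i` or by
`x_i ^ (δ_i + 1)`, where `i ≠ 0`, into a multiple of a monomial of smaller weight
(`exists_monomial_sub_mem_linearProductIdeal`). Modulo these monomials, multiplication by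
`(∑ x_i) ^ (D - 2 * k)` maps the forms of degree `k` onto the forms of degree `D - k`
(`exists_sub_pow_mul_mem_restrictSupport`): filtered by the first nonzero index other than `0`, the
monomial algebra has, apart from the powers of `x_0`, successive quotients that are, up to a shift
by one, quotients of monomial complete intersections of socle degree `D - 2`. For those, the
surjectivity is a statement about `sl₂`-modules, with the lowering operator
`∑ (γ_i ∂_i - x_i ∂_i²)` (`raise_pow_surjective`). Surjectivity is an open condition along the
one-parameter subgroup `x_i ↦ t ^ w_i * x_i`, which degenerates `A` to the monomial algebra, so for
almost every `t` the form `∑ t ^ w_i * x_i` has the same property on `A`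
(`finite_setOf_not_surjective_of_degeneration`).

Dimensions. Taken with the last index first, each generator with `i < m` is monic in a variable that
is absent from the previous ones, and the remaining generator is a nonzerodivisor because `a ≠ 1`
(`mem_chainIdeal_of_last_mul_mem`). So the generators form a regular sequence, the Hilbert series of
`A` is `∏ (1 + T + ⋯ + T ^ δ_i)` (`hilbertSeries_linearProductIdeal`), `A` is finite-dimensional,
and its Hilbert function is symmetric about `D / 2`. The surjections from degree `k` to
degree `D - k` are therefore bijections, which is the strong Lefschetz property
(`isStrongLefschetzElement_of_surjective`). -/

/-! ### Lowering operators and strong Lefschetz maps -/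

section Sl2

variable {K V : Type*} [Field K] [AddCommGroup V] [Module K V]

theorem pow_apply_mem_of_lowers {W : ℕ → Submodule K V} {F : V →ₗ[K] V}
    (hF : ∀ k, ∀ v ∈ W (k + 1), F v ∈ W k) {j i : ℕ} (hij : i ≤ j) {v : V} (hv : v ∈ W j) :
    (F ^ i) v ∈ W (j - i) := by
  induction i with
  | zero => simpa using hv
  | succ i ih =>
    rw [pow_succ', Module.End.mul_apply]
    apply hF
    have := ih (by omega)
    rwa [show j - i = j - (i + 1) + 1 by omega] at this

theorem pow_apply_mem_of_raises {W : ℕ → Submodule K V} {E : V →ₗ[K] V}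
    (hE : ∀ k, ∀ v ∈ W k, E v ∈ W (k + 1)) {j : ℕ} (i : ℕ) {v : V} (hv : v ∈ W j) :
    (E ^ i) v ∈ W (j + i) := by
  induction i with
  | zero => simpa using hv
  | succ i ih =>
    rw [pow_succ', Module.End.mul_apply]
    exact hE _ _ ih

/-- The standard `sl₂` computation for a vector killed by the raising operator. -/
theorem raise_lower_pow_succ {W : ℕ → Submodule K V} {E F : V →ₗ[K] V} {D : ℕ}
    (hF : ∀ k, ∀ v ∈ W (k + 1), F v ∈ W k)
    (hEF : ∀ k, ∀ v ∈ W k, E (F v) - F (E v) = (2 * k - D : K) • v)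
    {j i : ℕ} (hij : i ≤ j) {v : V} (hv : v ∈ W j) (hv0 : E v = 0) :
    E ((F ^ (i + 1)) v) = ((i + 1) * (2 * j - D - i) : K) • (F ^ i) v := by
  induction i with
  | zero =>
    have := hEF j v hv
    simp only [hv0, map_zero, sub_zero] at this
    simp [this]
  | succ i ih =>
    have h1 := hEF _ _ (pow_apply_mem_of_lowers hF hij hv)
    rw [ih (by omega), map_smul, sub_eq_iff_eq_add] at h1
    rw [pow_succ', Module.End.mul_apply, h1, ← Module.End.mul_apply, ← pow_succ', ← add_smul]
    congr 1
    push_cast [Nat.cast_sub hij]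
    ring

/-- A vector of degree `j` killed by the raising operator spans a string of length `2 * j - D`.
Going down this string and back up multiplies the vector by a nonzero scalar. -/
theorem exists_raise_pow_lower_pow [CharZero K] {W : ℕ → Submodule K V} {E F : V →ₗ[K] V} {D : ℕ}
    (hF : ∀ k, ∀ v ∈ W (k + 1), F v ∈ W k)
    (hEF : ∀ k, ∀ v ∈ W k, E (F v) - F (E v) = (2 * k - D : K) • v)
    {j : ℕ} (hj : j ≤ D) {v : V} (hv : v ∈ W j) (hv0 : E v = 0) (i : ℕ) (hi : D + i ≤ 2 * j) :
    ∃ c : K, c ≠ 0 ∧ (E ^ i) ((F ^ i) v) = c • v := by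
  induction i with
  | zero => exact ⟨1, one_ne_zero, by simp⟩
  | succ i ih =>
    obtain ⟨c, hc, h⟩ := ih (by omega)
    refine ⟨(i + 1) * (2 * j - D - i) * c, mul_ne_zero (mul_ne_zero ?_ ?_) hc, ?_⟩
    · exact_mod_cast Nat.succ_ne_zero i
    · rw [show (2 * j - D - i : K) = ((2 * j - D - i : ℕ) : K) by
        rw [Nat.cast_sub (by omega), Nat.cast_sub (by omega)]; push_cast; ring]
      exact_mod_cast (by omega : 2 * j - D - i ≠ 0)
    · rw [pow_succ E, Module.End.mul_apply, raise_lower_pow_succ hF hEF (by omega) hv hv0,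
        map_smul, h, smul_smul]

/-- In a graded space that vanishes in degrees above `D`, with a raising operator `E` and a lowering
operator `F` whose commutator is `2 * k - D` in degree `k`, the power `E ^ s` maps onto degree `j`
whenever the source degree `j - s` and the target degree `j` satisfy `(j - s) + j ≥ D`. The proof
is a descending induction on `j`: a vector is corrected by an element of the image until `E` kills
it, and a vector killed by `E` is a nonzero multiple of `E ^ i (F ^ i v)`. -/
theorem raise_pow_surjective [CharZero K] {W : ℕ → Submodule K V} {E F : V →ₗ[K] V} {D : ℕ}
    (hE : ∀ k, ∀ v ∈ W k, E v ∈ W (k + 1)) (hF : ∀ k, ∀ v ∈ W (k + 1), F v ∈ W k)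
    (hEF : ∀ k, ∀ v ∈ W k, E (F v) - F (E v) = (2 * k - D : K) • v)
    (hD : ∀ k, D < k → W k = ⊥) (j s : ℕ) (hsj : s ≤ j) (hs : D + s ≤ 2 * j) {v : V}
    (hv : v ∈ W j) : ∃ u ∈ W (j - s), (E ^ s) u = v := by
  induction h : D + 1 - j generalizing j s v with
  | zero =>
    rw [hD j (by omega), Submodule.mem_bot] at hv
    exact ⟨0, zero_mem _, by simp [hv]⟩
  | succ n ih =>
    have hjD : j ≤ D := by omega
    obtain ⟨u, hu, hu'⟩ : ∃ u ∈ W (j - s), E v = (E ^ (s + 1)) u := by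
      rcases hjD.lt_or_eq with hlt | rfl
      · obtain ⟨u, hu, hu'⟩ := ih (j + 1) (s + 2) (by omega) (by omega) (hE _ _ hv) (by omega)
        refine ⟨E u, ?_, ?_⟩
        · have := hE _ _ hu
          rwa [show j + 1 - (s + 2) + 1 = j - s by omega] at this
        · rw [← hu', ← Module.End.mul_apply, ← pow_succ]
      · have := hE _ _ hv
        rw [hD _ (by omega), Submodule.mem_bot] at this
        exact ⟨0, zero_mem _, by simp [this]⟩
    have hz : v - (E ^ s) u ∈ W j := by
      refine sub_mem hv ?_
      have := pow_apply_mem_of_raises hE s hu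
      rwa [Nat.sub_add_cancel hsj] at this
    have hz0 : E (v - (E ^ s) u) = 0 := by
      rw [map_sub, hu', pow_succ', Module.End.mul_apply, sub_self]
    obtain ⟨c, hc, h1⟩ := exists_raise_pow_lower_pow hF hEF hjD hz hz0 s hs
    refine ⟨u + c⁻¹ • (F ^ s) (v - (E ^ s) u), add_mem hu (Submodule.smul_mem _ _
      (pow_apply_mem_of_lowers hF hsj hz)), ?_⟩
    rw [map_add, map_smul, h1, smul_smul, inv_mul_cancel₀ hc, one_smul, add_sub_cancel]

end Sl2

/-! ### Monomial complete intersections -/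

section MonomialCI

open MvPolynomial

variable {K σ : Type*} [Field K]

/-- The ideal `(x_i ^ (γ_i + 1))` generated by powers of all the variables. -/
noncomputable def powerIdeal (K : Type*) [Field K] (γ : σ → ℕ) : Ideal (MvPolynomial σ K) :=
  Ideal.span (Set.range fun i => X i ^ (γ i + 1))

theorem mem_powerIdeal_iff (γ : σ → ℕ) (p : MvPolynomial σ K) :
    p ∈ powerIdeal K γ ↔ ∀ b ∈ p.support, ∃ i, γ i < b i := by
  have : (Set.range fun i => (X i : MvPolynomial σ K) ^ (γ i + 1)) =
      (fun s => monomial s (1 : K)) '' Set.range fun i => Finsupp.single i (γ i + 1) := by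
    rw [← Set.range_comp]
    congr 1
    ext1 i
    simp [X_pow_eq_monomial]
  rw [powerIdeal, this, mem_ideal_span_monomial_image]
  simp only [Set.exists_range_iff, Finsupp.single_le_iff, Nat.succ_le_iff]

theorem degree_eq_of_mem_support {p : MvPolynomial σ K} {N : ℕ}
    (hp : p.IsHomogeneous N) {b : σ →₀ ℕ} (hb : b ∈ p.support) : b.degree = N := by
  by_contra h
  exact mem_support_iff.mp hb (hp.coeff_eq_zero h)

variable [Fintype σ]

theorem mem_powerIdeal_of_isHomogeneous (γ : σ → ℕ) {p : MvPolynomial σ K} {N : ℕ}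
    (hp : p.IsHomogeneous N) (hN : ∑ i, γ i < N) : p ∈ powerIdeal K γ := by
  rw [mem_powerIdeal_iff]
  intro b hb
  by_contra! h
  have h1 := degree_eq_of_mem_support hp hb
  rw [Finsupp.degree_eq_sum] at h1
  have := Finset.sum_le_sum fun i (_ : i ∈ Finset.univ) => h i
  omega

/-- The lowering operator `∑ (γ_i ∂_i - x_i ∂_i²)` on polynomials. It makes the quotient by
`(x_i ^ (γ_i + 1))` the tensor product of the irreducible `sl₂`-modules of dimensions `γ_i + 1`. -/
noncomputable def loweringOperator (γ : σ → ℕ) : MvPolynomial σ K →ₗ[K] MvPolynomial σ K :=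
  ∑ i, ((γ i : K) • (pderiv i).toLinearMap -
    LinearMap.mulLeft K (X i) ∘ₗ (pderiv i).toLinearMap ∘ₗ (pderiv i).toLinearMap)

theorem loweringOperator_apply (γ : σ → ℕ) (p : MvPolynomial σ K) :
    loweringOperator γ p = ∑ i, (C (γ i : K) * pderiv i p - X i * pderiv i (pderiv i p)) := by
  simp [loweringOperator, LinearMap.sum_apply, smul_eq_C_mul]

theorem loweringOperator_isHomogeneous (γ : σ → ℕ) {p : MvPolynomial σ K} {k : ℕ}
    (hp : p.IsHomogeneous (k + 1)) : (loweringOperator γ p).IsHomogeneous k := by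
  rw [loweringOperator_apply]
  refine IsHomogeneous.sum _ _ _ fun i _ => ((hp.pderiv).C_mul _).sub ?_
  rcases k with _ | k
  · have h0 : (pderiv i p).IsHomogeneous 0 := hp.pderiv
    rw [← totalDegree_zero_iff_isHomogeneous, totalDegree_eq_zero_iff_eq_C] at h0
    rw [h0, pderiv_C, mul_zero]
    exact isHomogeneous_zero _ _ _
  · have := (isHomogeneous_X K i).mul ((hp.pderiv (i := i)).pderiv (i := i))
    rwa [show 1 + (k + 1 + 1 - 1 - 1) = k + 1 by omega] at this

theorem loweringOperator_mem_powerIdeal (γ : σ → ℕ) {p : MvPolynomial σ K}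
    (hp : p ∈ powerIdeal K γ) : loweringOperator γ p ∈ powerIdeal K γ := by
  classical
  obtain ⟨c, rfl⟩ := Ideal.mem_span_range_iff_exists_fun.mp hp
  rw [map_sum]
  refine sum_mem fun i _ => ?_
  have hi : (X i : MvPolynomial σ K) ^ (γ i + 1) ∈ powerIdeal K γ :=
    Ideal.subset_span ⟨i, rfl⟩
  rw [loweringOperator_apply]
  refine sum_mem fun j _ => ?_
  by_cases hij : i = j
  · subst hij
    -- the two terms in which `x_i ^ γ_i` survives cancel
    have : C (γ i : K) * pderiv i (c i * X i ^ (γ i + 1)) -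
        X i * pderiv i (pderiv i (c i * X i ^ (γ i + 1))) =
        (C (γ i : K) * pderiv i (c i) - X i * pderiv i (pderiv i (c i)) -
          2 * C (γ i + 1 : K) * pderiv i (c i)) * X i ^ (γ i + 1) := by
      rcases γ i with _ | g
      · simp
        ring
      · simp
        ring
    rw [this]
    exact Ideal.mul_mem_left _ _ hi
  · have : C (γ j : K) * pderiv j (c i * X i ^ (γ i + 1)) -
        X j * pderiv j (pderiv j (c i * X i ^ (γ i + 1))) =
        (C (γ j : K) * pderiv j (c i) - X j * pderiv j (pderiv j (c i))) * X i ^ (γ i + 1) := by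
      have h0 : pderiv j ((X i : MvPolynomial σ K) ^ (γ i + 1)) = 0 := by
        rw [pderiv_pow, pderiv_X_of_ne hij, mul_zero]
      simp only [pderiv_mul, h0, mul_zero, add_zero]
      ring
    rw [this]
    exact Ideal.mul_mem_left _ _ hi

/-- Multiplication by `∑ x_i` and the lowering operator have the commutator of an `sl₂`-triple. By
Euler's identity, it is the scalar `2 * k - ∑ γ_i` on the forms of degree `k`. -/
theorem commutator_loweringOperator (γ : σ → ℕ) {p : MvPolynomial σ K} {k : ℕ}
    (hp : p.IsHomogeneous k) :
    (∑ i, X i) * loweringOperator γ p - loweringOperator γ ((∑ i, X i) * p) =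
      (2 * k - (∑ i, γ i : ℕ) : K) • p := by
  classical
  have h1 : ∀ i, pderiv i (∑ j, (X j : MvPolynomial σ K)) = 1 := fun i => by
    simp [pderiv_X, Pi.single_apply]
  have h2 : (2 * k - (∑ i, γ i : ℕ) : K) • p =
      ∑ i, (2 * (X i * pderiv i p) - C (γ i : K) * p) := by
    rw [Finset.sum_sub_distrib, ← Finset.mul_sum, hp.sum_X_mul_pderiv, ← Finset.sum_mul,
      ← map_sum, smul_eq_C_mul]
    simp only [map_sub, map_mul, map_natCast, nsmul_eq_mul, map_ofNat, Nat.cast_sum]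
    ring
  rw [h2, loweringOperator_apply, loweringOperator_apply, Finset.mul_sum, ← Finset.sum_sub_distrib]
  refine Finset.sum_congr rfl fun i _ => ?_
  simp only [pderiv_mul, h1, map_add, one_mul]
  ring

/-- Surjective half of the strong Lefschetz property of a monomial complete intersection. -/
theorem exists_sub_pow_mul_mem_powerIdeal [CharZero K] (γ : σ → ℕ) {j s : ℕ} (hsj : s ≤ j)
    (hs : ∑ i, γ i + s ≤ 2 * j) {p : MvPolynomial σ K} (hp : p.IsHomogeneous j) :
    ∃ q : MvPolynomial σ K, q.IsHomogeneous (j - s) ∧ p - (∑ i, X i) ^ s * q ∈ powerIdeal K γ := by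
  set Q : Submodule K (MvPolynomial σ K) := (powerIdeal K γ).restrictScalars K with hQ
  have hEQ : Q ≤ Q.comap (LinearMap.mulLeft K (∑ i, X i)) := fun x hx =>
    Ideal.mul_mem_left (powerIdeal K γ) _ hx
  have hFQ : Q ≤ Q.comap (loweringOperator γ) := fun x hx => loweringOperator_mem_powerIdeal γ hx
  let W : ℕ → Submodule K (MvPolynomial σ K ⧸ Q) := fun k =>
    (homogeneousSubmodule σ K k).map Q.mkQ
  have hpow : ∀ (s : ℕ) (q : MvPolynomial σ K),
      (Q.mapQ Q (LinearMap.mulLeft K (∑ i, X i)) hEQ ^ s) (Q.mkQ q) =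
        Q.mkQ ((∑ i, X i) ^ s * q) := by
    intro s q
    induction s with
    | zero => simp
    | succ s ih =>
      rw [pow_succ', Module.End.mul_apply, ih, Submodule.mkQ_apply, Submodule.mapQ_apply,
        LinearMap.mulLeft_apply, Submodule.mkQ_apply, pow_succ', mul_assoc]
  obtain ⟨_, ⟨q, hq, rfl⟩, h⟩ : ∃ u ∈ W (j - s),
      (Q.mapQ Q (LinearMap.mulLeft K (∑ i, X i)) hEQ ^ s) u = Q.mkQ p := by
    refine raise_pow_surjective (F := Q.mapQ Q (loweringOperator γ) hFQ) (D := ∑ i, γ i)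
      ?_ ?_ ?_ ?_ j s hsj hs ⟨p, hp, rfl⟩
    · rintro k _ ⟨v, hv, rfl⟩
      refine ⟨(∑ i, X i) * v, ?_, rfl⟩
      rw [add_comm k]
      exact (IsHomogeneous.sum _ _ _ fun i _ => isHomogeneous_X K i).mul hv
    · rintro k _ ⟨v, hv, rfl⟩
      exact ⟨loweringOperator γ v, loweringOperator_isHomogeneous γ hv, rfl⟩
    · rintro k _ ⟨v, hv, rfl⟩
      rw [← map_smul, ← commutator_loweringOperator γ hv]
      rfl
    · intro k hk
      rw [eq_bot_iff]
      rintro _ ⟨v, hv, rfl⟩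
      rw [Submodule.mem_bot, Submodule.mkQ_apply, Submodule.Quotient.mk_eq_zero]
      exact mem_powerIdeal_of_isHomogeneous γ hv hk
  refine ⟨q, hq, ?_⟩
  rw [hpow, Submodule.mkQ_apply, Submodule.mkQ_apply, eq_comm, Submodule.Quotient.eq] at h
  exact h

end MonomialCI

/-! ### Degeneration along a weight -/

section Degeneration

open MvPolynomial

/-- If vectors `β_u` satisfy `β ≡ t * E(t) β` modulo a subspace, for a matrix `E` of polynomials,
then they all lie in the subspace unless `t` is a root of the polynomial `det (1 - X * E)`, which is
not zero because its constant term is `1`. -/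
theorem finite_setOf_not_forall_mem {K V ι : Type*} [Field K] [AddCommGroup V] [Module K V]
    [Fintype ι] [DecidableEq ι] (E : Matrix ι ι (Polynomial K)) :
    {t : K | ¬ ∀ (U : Submodule K V) (β : ι → V),
      (∀ u, β u - ∑ v, (t * (E u v).eval t) • β v ∈ U) → ∀ u, β u ∈ U}.Finite := by
  set M : Matrix ι ι (Polynomial K) := 1 - (Polynomial.X : Polynomial K) • E with hM
  have hmap : ∀ t : K, M.det.eval t = (1 - t • E.map (fun p : Polynomial K => p.eval t)).det := by
    intro t
    rw [← Polynomial.coe_evalRingHom, RingHom.map_det]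
    congr 1
    ext u v
    by_cases huv : u = v <;>
    simp [hM, huv]
  have h0 : M.det ≠ 0 := by
    intro h
    have := hmap 0
    simp [h] at this
  refine (M.det.rootSet_finite K).subset ?_
  intro t ht
  rw [Polynomial.mem_rootSet, Polynomial.coe_aeval_eq_eval]
  refine ⟨h0, ?_⟩
  by_contra hdet
  refine ht fun U β h u => ?_
  set A : Matrix ι ι K := 1 - t • E.map (fun p : Polynomial K => p.eval t) with hA
  have hu : IsUnit A.det := by
    rw [← hmap]
    exact isUnit_iff_ne_zero.mpr hdet
  have h1 : ∀ u, ∑ v, A u v • β v ∈ U := by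
    intro u
    convert h u using 1
    simp [hA, sub_smul, Finset.sum_sub_distrib, Matrix.one_apply]
  have h2 : β u = ∑ v, A⁻¹ u v • ∑ w, A v w • β w := by
    simp_rw [Finset.smul_sum, smul_smul]
    rw [Finset.sum_comm]
    simp_rw [← Finset.sum_smul, ← Matrix.mul_apply, Matrix.nonsing_inv_mul A hu]
    simp [Matrix.one_apply]
  rw [h2]
  exact sum_mem fun v _ => U.smul_mem _ (h1 v)

variable {K σ : Type*} [Field K]

/-- The action `x_i ↦ t ^ (w_i) x_i` of a one-parameter subgroup of the torus. -/
noncomputable def torusAction (w : σ → ℕ) (t : K) : MvPolynomial σ K →ₐ[K] MvPolynomial σ K :=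
  aeval fun i => C (t ^ w i) * X i

theorem torusAction_monomial (w : σ → ℕ) (t : K) (b : σ →₀ ℕ) (c : K) :
    torusAction w t (monomial b c) = t ^ Finsupp.weight w b • monomial b c := by
  rw [torusAction, aeval_monomial, monomial_eq, Finsupp.weight_apply]
  simp only [Finsupp.prod, mul_pow, Finset.prod_mul_distrib, Finsupp.sum, smul_eq_C_mul,
    Finset.prod_pow_eq_pow_sum, ← map_pow, ← map_prod, ← pow_mul, algebraMap_eq, smul_eq_mul,
    mul_comm (w _)]
  ring

theorem torusAction_isHomogeneous (w : σ → ℕ) (t : K) {p : MvPolynomial σ K} {k : ℕ}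
    (hp : p.IsHomogeneous k) : (torusAction w t p).IsHomogeneous k := by
  have := hp.aeval (fun i => C (t ^ w i) * X i) (n := 1) (fun i => isHomogeneous_C_mul_X _ i)
  rwa [one_mul] at this

variable [Fintype σ]

/-- If every monomial of degree `N` in `Bad` is congruent modulo `I` to a multiple of a monomial of
smaller weight, and if `(∑ x_i) ^ s` maps the forms of degree `k` onto the forms of degree `N`
modulo the span of the monomials in `Bad`, then for almost all `t` the power
`(∑ t ^ (w_i) x_i) ^ s` maps the forms of degree `k` onto the forms of degree `N` modulo `I`.
After the substitution `x_i ↦ t ^ (w_i) x_i`, each monomial of degree `N` lies in the image modulo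
`I` up to `t` times a combination of monomials with coefficients polynomial in `t`. -/
theorem finite_setOf_not_surjective_of_degeneration (w : σ → ℕ) (I : Ideal (MvPolynomial σ K))
    (Bad : (σ →₀ ℕ) → Prop) {N k s : ℕ}
    (hBad : ∀ b : σ →₀ ℕ, b.degree = N → Bad b → ∃ (c : K) (b' : σ →₀ ℕ), b'.degree = N ∧
      Finsupp.weight w b' < Finsupp.weight w b ∧ monomial b 1 - monomial b' c ∈ I)
    (hsurj : ∀ p : MvPolynomial σ K, p.IsHomogeneous N → ∃ q : MvPolynomial σ K,
      q.IsHomogeneous k ∧ p - (∑ i, X i) ^ s * q ∈ restrictSupport K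
        {b | b.degree = N ∧ Bad b}) :
    {t : K | ¬ ∀ p : MvPolynomial σ K, p.IsHomogeneous N → ∃ q : MvPolynomial σ K,
      q.IsHomogeneous k ∧ p - (∑ i, C (t ^ w i) * X i) ^ s * q ∈ I}.Finite := by
  classical
  let ι := {b : σ →₀ ℕ // b ∈ Finset.univ.finsuppAntidiag N}
  let : Fintype ι := Finset.Subtype.fintype _
  have hι : ∀ b : σ →₀ ℕ, b ∈ Finset.univ.finsuppAntidiag N ↔ b.degree = N := by
    intro b
    simp [Finset.mem_finsuppAntidiag, Finsupp.degree_eq_sum]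
  have h1 : ∀ u : ι, ∃ (q : MvPolynomial σ K) (f : MvPolynomial σ K), q.IsHomogeneous k ∧
      (∀ b ∈ f.support, b.degree = N ∧ Bad b) ∧
      monomial u.1 1 - (∑ i, X i) ^ s * q = f := by
    intro u
    obtain ⟨q, hq, h⟩ := hsurj (monomial u.1 1) (isHomogeneous_monomial _ ((hι _).mp u.2))
    refine ⟨q, _, hq, fun b hb => ((mem_restrictSupport_iff K).mp h) hb, rfl⟩
  choose q f hq hf hqf using h1
  have h2 : ∀ v : ι, ∃ (c : K) (v' : ι), Bad v.1 → Finsupp.weight w v'.1 < Finsupp.weight w v.1 ∧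
      monomial v.1 1 - monomial v'.1 c ∈ I := by
    intro v
    by_cases hv : Bad v.1
    · obtain ⟨c, b', hb', h⟩ := hBad v.1 ((hι _).mp v.2) hv
      exact ⟨c, ⟨b', (hι _).mpr hb'⟩, fun _ => h⟩
    · exact ⟨0, v, fun h => absurd h hv⟩
  choose c ρ hρ using h2
  let E : Matrix ι ι (Polynomial K) := fun u v' => ∑ v : ι, if ρ v = v' then
    Polynomial.C (coeff v.1 (f u) * c v) *
      Polynomial.X ^ (Finsupp.weight w v.1 - Finsupp.weight w (ρ v).1 - 1) else 0
  have hE : ∀ (t : K) (u : ι) (β : ι → MvPolynomial σ K),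
      ∑ v', (t * (E u v').eval t) • β v' = ∑ v : ι, (t * (coeff v.1 (f u) * c v *
        t ^ (Finsupp.weight w v.1 - Finsupp.weight w (ρ v).1 - 1))) • β (ρ v) := by
    intro t u β
    simp only [E, Polynomial.eval_finsetSum, Finset.mul_sum, Finset.sum_smul]
    rw [Finset.sum_comm]
    refine Finset.sum_congr rfl fun v _ => ?_
    rw [Finset.sum_eq_single (ρ v) (fun b _ hb => by simp [hb.symm]) (by simp)]
    simp
  refine ((finite_setOf_not_forall_mem (V := MvPolynomial σ K) E).union
    (Set.finite_singleton 0)).subset fun t ht => ?_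
  by_contra hcon
  simp only [Set.mem_union, Set.mem_ofPred_eq, not_not, Set.mem_singleton_iff, not_or] at hcon
  obtain ⟨hcon, ht0⟩ := hcon
  apply ht
  set U : Submodule K (MvPolynomial σ K) := I.restrictScalars K ⊔
    (homogeneousSubmodule σ K k).map (LinearMap.mulLeft K ((∑ i, C (t ^ w i) * X i) ^ s)) with hU
  have key : ∀ u : ι, torusAction w t (monomial u.1 1) ∈ U := by
    refine hcon U (fun u => torusAction w t (monomial u.1 1)) fun u => ?_
    rw [hE]
    have h3 : torusAction w t (monomial u.1 1) = (∑ i, C (t ^ w i) * X i) ^ s *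
        torusAction w t (q u) + torusAction w t (f u) := by
      rw [← hqf, map_sub, map_mul, map_pow, map_sum]
      simp [torusAction]
    have h4 : torusAction w t (f u) =
        ∑ v : ι, coeff v.1 (f u) • torusAction w t (monomial v.1 1) := by
      have : f u = ∑ v : ι, coeff v.1 (f u) • monomial v.1 1 := by
        conv_lhs => rw [(f u).as_sum]
        rw [Finset.sum_coe_sort (Finset.univ.finsuppAntidiag N)
          (fun b => coeff b (f u) • monomial b (1 : K))]
        refine Finset.sum_subset_zero_on_sdiff (fun b hb => (hι b).mpr (hf u b hb).1)
          (fun b hb => ?_) (fun b _ => by simp [smul_monomial])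
        rw [notMem_support_iff.mp (Finset.mem_sdiff.mp hb).2, zero_smul]
      conv_lhs => rw [this]
      simp
    rw [h3, h4, add_sub_assoc, ← Finset.sum_sub_distrib]
    refine add_mem (Submodule.mem_sup_right ⟨_, torusAction_isHomogeneous w t (hq u), rfl⟩)
      (Submodule.mem_sup_left (sum_mem fun v _ => ?_))
    by_cases hv : coeff v.1 (f u) = 0
    · simp [hv]
    · obtain ⟨hlt, hmem⟩ := hρ v (hf u v.1 (mem_support_iff.mpr hv)).2
      have h5 : coeff v.1 (f u) • torusAction w t (monomial v.1 1) - (t * (coeff v.1 (f u) * c v *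
          t ^ (Finsupp.weight w v.1 - Finsupp.weight w (ρ v).1 - 1))) •
            torusAction w t (monomial (ρ v).1 1) =
          (coeff v.1 (f u) * t ^ Finsupp.weight w v.1) •
            (monomial v.1 1 - monomial (ρ v).1 (c v)) := by
        have h6 : t ^ Finsupp.weight w v.1 = t * t ^ (Finsupp.weight w v.1 -
            Finsupp.weight w (ρ v).1 - 1) * t ^ Finsupp.weight w (ρ v).1 := by
          rw [← pow_succ', ← pow_add]
          congr 1
          omega
        have h7 : (monomial (ρ v).1 (c v) : MvPolynomial σ K) = c v • monomial (ρ v).1 1 := by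
          rw [smul_monomial, smul_eq_mul, mul_one]
        rw [torusAction_monomial, torusAction_monomial, h7, smul_sub, smul_smul, smul_smul,
          smul_smul, h6]
        congr 2
        ring
      rw [h5]
      exact Submodule.smul_mem _ _ hmem
  intro p hp
  have hpU : p ∈ U := by
    rw [p.as_sum]
    refine sum_mem fun b hb => ?_
    have h8 := key ⟨b, (hι b).mpr (degree_eq_of_mem_support hp hb)⟩
    rw [torusAction_monomial] at h8
    have h9 := U.smul_mem (coeff b p * (t ^ Finsupp.weight w b)⁻¹) h8
    rwa [smul_smul, mul_assoc, inv_mul_cancel₀ (pow_ne_zero _ ht0), mul_one, smul_monomial,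
      smul_eq_mul, mul_one] at h9
  obtain ⟨y, hy, _, ⟨z, hz, rfl⟩, h⟩ := Submodule.mem_sup.mp hpU
  refine ⟨z, hz, ?_⟩
  rw [← h]
  simpa using hy

end Degeneration

/-! ### The monomial degeneration -/

section MonomialModel

open MvPolynomial

variable {K : Type*} [Field K] {m : ℕ}

/-- The exponents of the monomials divisible by `x_0 ^ (δ_0 + ⋯ + δ_{i-1}) * x_i` or by
`x_i ^ (δ_i + 1)` for some `i ≠ 0`. -/
def IsLeadingExponent (δ : Fin (m + 1) → ℕ) (b : Fin (m + 1) →₀ ℕ) : Prop :=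
  (∃ i ≠ 0, ∑ j ∈ Finset.Iio i, δ j ≤ b 0 ∧ 1 ≤ b i) ∨ ∃ i ≠ 0, δ i < b i

/-- The exponents of the monomial complete intersection that governs multiplication by `x_r` on the
monomial model: `x_0 ^ (δ_0 + ⋯ + δ_{r-1})`, `x_j` for `0 < j < r`, `x_r ^ δ_r` and
`x_j ^ (δ_j + 1)` for `j > r`, each lowered by one as in `powerIdeal`. -/
def sectionExponent (δ : Fin (m + 1) → ℕ) (r j : Fin (m + 1)) : ℕ :=
  if j = 0 then ∑ j ∈ Finset.Iio r, δ j - 1 else if j < r then 0 else if j = r then δ r - 1 else δ j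

theorem sum_sectionExponent_add_two (δ : Fin (m + 1) → ℕ) (hδ : ∀ i, 0 < δ i) {r : Fin (m + 1)}
    (hr : r ≠ 0) : ∑ j, sectionExponent δ r j + 2 = ∑ j, δ j := by
  have he : 0 < ∑ j ∈ Finset.Iio r, δ j :=
    Finset.sum_pos (fun i _ => hδ i) ⟨0, Finset.mem_Iio.mpr (Fin.pos_iff_ne_zero.mpr hr)⟩
  have h : ∀ j, sectionExponent δ r j + (if j = 0 then 1 else 0) + (if j = r then 1 else 0) =
      (if j = 0 then ∑ j ∈ Finset.Iio r, δ j else 0) + if r ≤ j then δ j else 0 := by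
    intro j
    unfold sectionExponent
    have := hδ r
    rcases eq_or_ne j 0 with rfl | hj
    · have h0 : ¬ r ≤ 0 := by simpa using hr
      simp only [if_true, hr.symm, if_false, h0]
      omega
    · rcases lt_trichotomy j r with hlt | rfl | hlt
      · simp [hj, hlt, hlt.ne]
      · simp [hj]
        omega
      · simp [hj, hlt.ne', hlt.not_gt, hlt.le]
  have h2 := Finset.sum_congr (rfl : Finset.univ = Finset.univ) fun j _ => h j
  simp only [Finset.sum_add_distrib, Finset.sum_ite_eq', Finset.mem_univ, if_true] at h2
  rw [← Finset.sum_filter] at h2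
  have h3 := Finset.sum_filter_add_sum_filter_not Finset.univ (fun j => r ≤ j) δ
  have h4 : Finset.univ.filter (fun j => ¬ r ≤ j) = Finset.Iio r := by ext; simp
  rw [h4] at h3
  omega

/-- Modulo the monomials with leading exponent, multiplication by the power of `∑ x_i` of exponent
`D - 2 * k` maps the forms of degree `k` onto the forms of degree `D - k`, where `D = ∑ δ_i`. A
product `x_r * g` is handled by induction on `r`: modulo the products with smaller `r`, the
annihilator of `x_r` contains `powerIdeal K (sectionExponent δ r)`, the ideal of a monomial complete
intersection of socle degree `D - 2`. -/
theorem exists_sub_pow_mul_mem_restrictSupport [CharZero K] (δ : Fin (m + 1) → ℕ)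
    (hδ : ∀ i, 0 < δ i) {k N s : ℕ} (hN : N + k = ∑ i, δ i) (hs : s + k = N)
    {p : MvPolynomial (Fin (m + 1)) K} (hp : p.IsHomogeneous N) :
    ∃ q : MvPolynomial (Fin (m + 1)) K, q.IsHomogeneous k ∧
      p - (∑ i, X i) ^ s * q ∈ restrictSupport K {b | b.degree = N ∧ IsLeadingExponent δ b} := by
  rcases Nat.eq_zero_or_pos s with rfl | hs0
  · refine ⟨p, by rwa [show k = N by omega], ?_⟩
    rw [pow_zero, one_mul, sub_self]
    exact zero_mem _
  set l : MvPolynomial (Fin (m + 1)) K := ∑ i, X i with hl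
  have hlhom : l.IsHomogeneous 1 := IsHomogeneous.sum _ _ _ fun i _ => isHomogeneous_X K i
  set G : Submodule K (MvPolynomial (Fin (m + 1)) K) :=
    (homogeneousSubmodule _ K k).map (LinearMap.mulLeft K (l ^ s)) ⊔
      restrictSupport K {b | b.degree = N ∧ IsLeadingExponent δ b} with hG
  have hlead : ∀ (b : Fin (m + 1) →₀ ℕ) (c : K), b.degree = N → IsLeadingExponent δ b →
      monomial b c ∈ G := fun b c hb hb' =>
    Submodule.mem_sup_right ((monomial_mem_restrictSupport K).mpr (Or.inl ⟨hb, hb'⟩))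
  have hmul : ∀ q : MvPolynomial (Fin (m + 1)) K, q.IsHomogeneous k → l ^ s * q ∈ G :=
    fun q hq => Submodule.mem_sup_left ⟨q, hq, rfl⟩
  have hX : ∀ (r : Fin (m + 1)) (b : Fin (m + 1) →₀ ℕ) (c : K),
      X r * monomial b c = monomial (b + Finsupp.single r 1) c := fun r b c => by
    rw [mul_comm, X, monomial_mul, mul_one]
  have key : ∀ r : Fin (m + 1), r ≠ 0 → ∀ g : MvPolynomial (Fin (m + 1)) K, ∀ M, M + 1 = N →
      g.IsHomogeneous M → X r * g ∈ G := by
    intro r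
    induction r using WellFoundedLT.induction with
    | _ r ih =>
    intro hr g M hM hg
    have hsum := sum_sectionExponent_add_two δ hδ hr
    have hz : ∀ z : MvPolynomial (Fin (m + 1)) K, z.IsHomogeneous M →
        z ∈ powerIdeal K (sectionExponent δ r) → X r * z ∈ G := by
      intro z hzM hzQ
      rw [mem_powerIdeal_iff] at hzQ
      rw [z.as_sum, Finset.mul_sum]
      refine sum_mem fun b hb => ?_
      have hbM := degree_eq_of_mem_support hzM hb
      obtain ⟨i, hi⟩ := hzQ b hb
      have hdeg : (b + Finsupp.single r 1).degree = N := by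
        rw [map_add, hbM, Finsupp.degree_single, hM]
      unfold sectionExponent at hi
      split_ifs at hi with h0 h1 h2
      · subst h0
        rw [hX]
        refine hlead _ _ hdeg (Or.inl ⟨r, hr, ?_, by simp⟩)
        simp only [Finsupp.add_apply]
        omega
      · have hb1 : b = (b - Finsupp.single i 1) + Finsupp.single i 1 := by
          rw [tsub_add_cancel_of_le]
          rw [Finsupp.single_le_iff]
          omega
        rw [hb1, ← hX, mul_left_comm]
        refine ih i h1 h0 _ M hM ?_
        rw [hX]
        refine isHomogeneous_monomial _ ?_
        rw [← hbM, hb1]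
        simp
      · subst h2
        rw [hX]
        refine hlead _ _ hdeg (Or.inr ⟨i, hr, ?_⟩)
        simp only [Finsupp.add_apply, Finsupp.single_eq_same]
        omega
      · rw [hX]
        refine hlead _ _ hdeg (Or.inr ⟨i, h0, ?_⟩)
        simp only [Finsupp.add_apply]
        omega
    rcases k with _ | k
    · exact hz g hg (mem_powerIdeal_of_isHomogeneous _ hg (by omega))
    · obtain ⟨q, hq, hgq⟩ := exists_sub_pow_mul_mem_powerIdeal (sectionExponent δ r)
        (j := M) (s := s) (by omega) (by omega) hg
      rw [show M - s = k by omega] at hq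
      have h1 : X r * g = l ^ s * (X r * q) + X r * (g - l ^ s * q) := by ring
      rw [h1]
      refine add_mem (hmul _ ?_) (hz _ (hg.sub ?_) hgq)
      · rw [add_comm k 1]
        exact (isHomogeneous_X K r).mul hq
      · have := (hlhom.pow s).mul hq
        rwa [show 1 * s + k = M by omega] at this
  have hpG : p ∈ G := by
    rw [p.as_sum]
    refine sum_mem fun b hb => ?_
    have hbN := degree_eq_of_mem_support hp hb
    by_cases hr : ∃ r ≠ 0, 1 ≤ b r
    · obtain ⟨r, hr, hbr⟩ := hr
      have hb1 : b = (b - Finsupp.single r 1) + Finsupp.single r 1 := by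
        rw [tsub_add_cancel_of_le]
        rwa [Finsupp.single_le_iff]
      have hb2 : (b - Finsupp.single r 1).degree + 1 = N := by
        rw [← hbN]
        conv_rhs => rw [hb1]
        simp
      rw [hb1, ← hX]
      exact key r hr _ _ hb2 (isHomogeneous_monomial _ rfl)
    · push Not at hr
      have hb1 : b = Finsupp.single 0 N := by
        have h0 : b = Finsupp.single 0 (b 0) := by
          ext i
          rcases eq_or_ne i 0 with rfl | hi
          · simp
          · rw [Finsupp.single_eq_of_ne hi]
            have := hr i hi
            omega
        rw [h0, Finsupp.degree_single] at hbN
        rw [h0, hbN]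
      -- `ℓ ^ s - x_0 ^ s` is a multiple of `ℓ - x_0`, the sum of the other variables
      obtain ⟨h, hh, hls⟩ : ∃ h : MvPolynomial (Fin (m + 1)) K, h.IsHomogeneous (s - 1) ∧
          l ^ s - X 0 ^ s = h * (l - X 0) := by
        refine ⟨_, ?_, (Commute.geom_sum₂_mul (Commute.all _ _) s).symm⟩
        refine IsHomogeneous.sum _ _ _ fun i hi => ?_
        have := (hlhom.pow i).mul ((isHomogeneous_X K (0 : Fin (m + 1))).pow (s - 1 - i))
        have hi' := Finset.mem_range.mp hi
        rwa [show 1 * i + 1 * (s - 1 - i) = s - 1 by omega] at this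
      have hc : ∀ n (c : K), monomial (Finsupp.single (0 : Fin (m + 1)) n) c = C c * X 0 ^ n := by
        intro n c
        rw [X_pow_eq_monomial, C_mul_monomial, mul_one]
      have hk := isHomogeneous_C_mul_X_pow (coeff b p) (0 : Fin (m + 1)) k
      have h1 : monomial b (coeff b p) = l ^ s * (C (coeff b p) * X 0 ^ k) -
          ∑ r ∈ Finset.univ.erase 0, X r * (h * (C (coeff b p) * X 0 ^ k)) := by
        rw [← Finset.sum_mul, Finset.sum_erase_eq_sub (Finset.mem_univ _), ← hl]
        have h2 : monomial b (coeff b p) = C (coeff b p) * X 0 ^ (s + k) := by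
          rw [hs, ← hc, ← hb1]
        rw [h2, pow_add]
        linear_combination (- C (coeff b p) * X 0 ^ k) * hls
      rw [h1]
      refine sub_mem (hmul _ hk) (sum_mem fun r hr' => ?_)
      exact key r (Finset.ne_of_mem_erase hr') _ (s - 1 + k) (by omega) (hh.mul hk)
  obtain ⟨_, ⟨q, hq, rfl⟩, z, hz, hqz⟩ := Submodule.mem_sup.mp hpG
  refine ⟨q, hq, ?_⟩
  rw [← hqz]
  simpa using hz

end MonomialModel

/-! ### Relations in the product ideal -/

section Relations

open MvPolynomial

variable {K : Type*} [Field K] {m : ℕ}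

/-- The ideal generated by `x_i ^ (δ_i) * (x_i - x_{i+1})` for all `i` but the last. -/
noncomputable def chainIdeal (K : Type*) [Field K] {m : ℕ} (δ : Fin (m + 1) → ℕ) :
    Ideal (MvPolynomial (Fin (m + 1)) K) :=
  Ideal.span (Set.range fun i : Fin m =>
    X i.castSucc ^ δ i.castSucc * (X i.castSucc - X i.succ))

/-- The exponents `d` indexed by the variables: `d_0` belongs to the last variable. -/
def cyclicExponent (d : Fin (m + 1) → ℕ) : Fin (m + 1) → ℕ :=
  Fin.snoc (α := fun _ => ℕ) (fun i : Fin m => d i.succ) (d 0)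

theorem cyclicExponent_castSucc (d : Fin (m + 1) → ℕ) (i : Fin m) :
    cyclicExponent d i.castSucc = d i.succ := by
  simp [cyclicExponent]

theorem cyclicExponent_last (d : Fin (m + 1) → ℕ) : cyclicExponent d (Fin.last m) = d 0 := by
  simp [cyclicExponent]

theorem cyclicExponent_pos {d : Fin (m + 1) → ℕ} (hd : ∀ i, 0 < d i) (i : Fin (m + 1)) :
    0 < cyclicExponent d i := by
  induction i using Fin.lastCases with
  | last => rw [cyclicExponent_last]; exact hd _
  | cast i => rw [cyclicExponent_castSucc]; exact hd _

theorem linearProductIdeal_eq (d : Fin (m + 1) → ℕ) (a : K) :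
    linearProductIdeal m d a = chainIdeal K (cyclicExponent d) ⊔ Ideal.span {X (Fin.last m) ^
      cyclicExponent d (Fin.last m) * (X (Fin.last m) - C a * X 0)} := by
  rw [linearProductIdeal, Ideal.span_insert, chainIdeal, sup_comm, cyclicExponent_last]
  simp_rw [cyclicExponent_castSucc]

/-- Elimination along the chain of relations `x_i ^ (δ_i) * (x_i - x_{i+1})`. -/
theorem X_zero_pow_mul_sub_mem_chainIdeal (δ : Fin (m + 1) → ℕ) (i : Fin (m + 1)) :
    X 0 ^ (∑ j ∈ Finset.Iio i, δ j) * (X 0 - X i) ∈ chainIdeal K δ := by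
  induction i using Fin.induction with
  | zero => simp
  | succ i ih =>
    have h1 : Finset.Iio i.succ = insert i.castSucc (Finset.Iio i.castSucc) := by
      ext j
      simp only [Finset.mem_Iio, Finset.mem_insert, Fin.lt_def, Fin.ext_iff, Fin.val_succ,
        Fin.val_castSucc]
      omega
    rw [h1, Finset.sum_insert (by simp)]
    set e := ∑ j ∈ Finset.Iio i.castSucc, δ j
    set n := δ i.castSucc with hn
    -- modulo the ideal, `x_0 ^ e * g (x_0) = x_0 ^ e * g (x_i)` for every polynomial `g`
    obtain ⟨u, hu⟩ := sub_dvd_pow_sub_pow (X 0 : MvPolynomial (Fin (m + 1)) K) (X i.castSucc) n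
    obtain ⟨v, hv⟩ := sub_dvd_pow_sub_pow (X 0 : MvPolynomial (Fin (m + 1)) K) (X i.castSucc)
      (n + 1)
    have h2 : (X 0 : MvPolynomial (Fin (m + 1)) K) ^ (n + e) * (X 0 - X i.succ) =
        (v - u * X i.succ) * (X 0 ^ e * (X 0 - X i.castSucc)) +
          X 0 ^ e * (X i.castSucc ^ n * (X i.castSucc - X i.succ)) := by
      rw [pow_add]
      linear_combination (X 0 ^ e) * hv - X 0 ^ e * X i.succ * hu
    rw [h2]
    exact add_mem (Ideal.mul_mem_left _ _ ih)
      (Ideal.mul_mem_left _ _ (Ideal.subset_span ⟨i, rfl⟩))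

/-- Weights of the variables, with `w_0 < w_m < ⋯ < w_1`. -/
def chainWeight (i : Fin (m + 1)) : ℕ := if i = 0 then 0 else m + 1 - i

theorem exists_monomial_sub_mem {I : Ideal (MvPolynomial (Fin (m + 1)) K)}
    {w : Fin (m + 1) → ℕ} {v b : Fin (m + 1) →₀ ℕ} {i i' : Fin (m + 1)} {c : K}
    (hw : w i' < w i) (hb : v + Finsupp.single i 1 ≤ b)
    (hI : monomial v 1 * (X i - C c * X i') ∈ I) :
    ∃ (c : K) (b' : Fin (m + 1) →₀ ℕ), b'.degree = b.degree ∧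
      Finsupp.weight w b' < Finsupp.weight w b ∧ monomial b 1 - monomial b' c ∈ I := by
  obtain ⟨u, rfl⟩ := exists_add_of_le hb
  refine ⟨c, v + Finsupp.single i' 1 + u, by simp, ?_, ?_⟩
  · simp only [map_add, Finsupp.weight_single, one_smul]
    omega
  · have h : monomial (v + Finsupp.single i 1 + u) (1 : K) -
        monomial (v + Finsupp.single i' 1 + u) c =
        monomial u 1 * (monomial v 1 * (X i - C c * X i')) := by
      simp only [X, C_mul_monomial, mul_sub, monomial_mul, mul_one, one_mul]
      rw [add_comm _ u, add_comm _ u]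
    rw [h]
    exact Ideal.mul_mem_left _ _ hI

/-- Modulo the product ideal, a monomial with leading exponent is a multiple of a monomial of the
same degree and of smaller weight. -/
theorem exists_monomial_sub_mem_linearProductIdeal (d : Fin (m + 1) → ℕ) (a : K)
    {b : Fin (m + 1) →₀ ℕ} (hb : IsLeadingExponent (cyclicExponent d) b) :
    ∃ (c : K) (b' : Fin (m + 1) →₀ ℕ), b'.degree = b.degree ∧
      Finsupp.weight chainWeight b' < Finsupp.weight chainWeight b ∧
        monomial b 1 - monomial b' c ∈ linearProductIdeal m d a := by
  rw [linearProductIdeal_eq]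
  set δ := cyclicExponent d
  have hle : ∀ (j i : Fin (m + 1)) (n : ℕ), j ≠ i → n ≤ b j → 1 ≤ b i →
      Finsupp.single j n + Finsupp.single i 1 ≤ b := by
    intro j i n hji hn hi k
    rw [Finsupp.add_apply, Finsupp.single_apply, Finsupp.single_apply]
    split_ifs with h1 h2 h2
    · exact absurd (h1.trans h2.symm) hji
    · rwa [← h1]
    · rwa [← h2, zero_add]
    · simp
  have hle' : ∀ i : Fin (m + 1), δ i < b i →
      Finsupp.single i (δ i) + Finsupp.single i 1 ≤ b := by
    intro i hi
    rw [← Finsupp.single_add, Finsupp.single_le_iff]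
    exact hi
  rcases hb with ⟨i, hi, h0, hi1⟩ | ⟨i, hi, hib⟩
  · refine exists_monomial_sub_mem (i := i) (i' := 0) (c := 1) ?_ (hle 0 i _ hi.symm h0 hi1) ?_
    · simp only [chainWeight, if_true, hi, if_false]
      omega
    · refine Ideal.mem_sup_left ?_
      have := neg_mem (X_zero_pow_mul_sub_mem_chainIdeal (K := K) δ i)
      rw [← X_pow_eq_monomial, C_1, one_mul]
      rwa [← mul_neg, neg_sub] at this
  · induction i using Fin.lastCases with
    | last =>
      refine exists_monomial_sub_mem (i := Fin.last m) (i' := 0) (c := a) ?_ (hle' _ hib) ?_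
      · simp only [chainWeight, if_true, hi, if_false]
        simp
      · rw [← X_pow_eq_monomial]
        exact Ideal.mem_sup_right (Ideal.subset_span rfl)
    | cast i =>
      refine exists_monomial_sub_mem (i := i.castSucc) (i' := i.succ) (c := 1) ?_ (hle' _ hib) ?_
      · simp only [chainWeight, hi, if_false, Fin.succ_ne_zero, Fin.val_succ, Fin.val_castSucc]
        omega
      · rw [← X_pow_eq_monomial, C_1, one_mul]
        exact Ideal.mem_sup_left (Ideal.subset_span ⟨i, rfl⟩)

end Relations

/-! ### Regularity -/

section Regularity

open RingTheory.Sequence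

theorem isWeaklyRegular_append_singleton_iff {R : Type*} [CommRing R] (rs : List R) (f : R) :
    IsWeaklyRegular R (rs ++ [f]) ↔ IsWeaklyRegular R rs ∧
      ∀ p, f * p ∈ Ideal.ofList rs → p ∈ Ideal.ofList rs := by
  rw [isWeaklyRegular_append_iff, isWeaklyRegular_singleton_iff,
    isSMulRegular_iff_right_eq_zero_of_smul, Submodule.mkQ_surjective _ |>.forall]
  simp only [Submodule.mkQ_apply, ← Submodule.Quotient.mk_smul, Submodule.Quotient.mk_eq_zero,
    smul_eq_mul, Ideal.mul_top]

theorem isWeaklyRegular_map_ringEquiv {R S : Type*} [CommRing R] [CommRing S] (e : R ≃+* S)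
    {rs : List R} (h : IsWeaklyRegular R rs) : IsWeaklyRegular S (rs.map e) := by
  refine (AddEquiv.isWeaklyRegular_congr (e := e.toAddEquiv) ?_).mp h
  exact List.forall₂_map_right_iff.mpr (List.forall₂_same.mpr fun r _ x => by simp)

open Polynomial in
theorem mem_map_C_iff_map_mk_eq_zero {B : Type*} [CommRing B] (J : Ideal B) (p : B[X]) :
    p ∈ J.map C ↔ p.map (Ideal.Quotient.mk J) = 0 := by
  rw [Ideal.mem_map_C_iff, Polynomial.ext_iff]
  simp [Ideal.Quotient.eq_zero_iff_mem]

open Polynomial in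
theorem isWeaklyRegular_map_C_append_monic {B : Type*} [CommRing B] {rs : List B}
    (h : IsWeaklyRegular B rs) {g : B[X]} (hg : g.Monic) :
    IsWeaklyRegular B[X] (rs.map C ++ [g]) := by
  rw [isWeaklyRegular_append_singleton_iff]
  refine ⟨h.of_flat, fun p hp => ?_⟩
  rw [← Ideal.map_ofList, mem_map_C_iff_map_mk_eq_zero] at hp ⊢
  rw [Polynomial.map_mul] at hp
  exact (hg.map _).mul_right_eq_zero_iff.mp hp

open Polynomial in
/-- A nonzerodivisor modulo an ideal of `B` stays one after adjoining a root of a monic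
polynomial. -/
theorem mem_of_C_mul_mem {B : Type*} [CommRing B] {J : Ideal B} {y : B}
    (hy : ∀ b, y * b ∈ J → b ∈ J) {g : B[X]} (hg : g.Monic) {p : B[X]}
    (hp : C y * p ∈ J.map C ⊔ Ideal.span {g}) : p ∈ J.map C ⊔ Ideal.span {g} := by
  nontriviality B
  have h1 : p - p %ₘ g ∈ J.map C ⊔ Ideal.span {g} :=
    Ideal.mem_sup_right (Ideal.mem_span_singleton.mpr ⟨p /ₘ g, by
      linear_combination -(modByMonic_add_div p g)⟩)
  rw [← sub_add_cancel p (p %ₘ g)]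
  refine add_mem h1 (Ideal.mem_sup_left ?_)
  have h2 : C y * (p %ₘ g) ∈ J.map C ⊔ Ideal.span {g} := by
    have := sub_mem hp (Ideal.mul_mem_left _ (C y) h1)
    rwa [← mul_sub, sub_sub_cancel] at this
  obtain ⟨c, hc, z, hz, hcz⟩ := Submodule.mem_sup.mp h2
  obtain ⟨q, rfl⟩ := Ideal.mem_span_singleton.mp hz
  set φ := Ideal.Quotient.mk J
  rw [mem_map_C_iff_map_mk_eq_zero] at hc
  have h3 : (g.map φ) * (q.map φ) = C (φ y) * (p %ₘ g).map φ := by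
    have := congrArg (Polynomial.map φ) hcz
    rw [Polynomial.map_add, hc, zero_add, Polynomial.map_mul, Polynomial.map_mul, map_C] at this
    exact this
  -- the left side is a multiple of a monic polynomial, the right side has smaller degree
  have h4 : C (φ y) * (p %ₘ g).map φ = 0 := by
    by_contra hne
    have : Nontrivial (B ⧸ J) := by
      by_contra hn
      rw [not_nontrivial_iff_subsingleton] at hn
      exact hne (Subsingleton.elim _ _)
    refine (hg.map φ).not_dvd_of_degree_lt hne ?_ ⟨_, h3.symm⟩
    calc (C (φ y) * (p %ₘ g).map φ).degree ≤ ((p %ₘ g).map φ).degree := by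
          rw [← smul_eq_C_mul]
          exact degree_smul_le _ _
      _ ≤ (p %ₘ g).degree := degree_map_le
      _ < g.degree := degree_modByMonic_lt _ hg
      _ = (g.map φ).degree := (hg.degree_map φ).symm
  rw [Ideal.mem_map_C_iff]
  intro n
  apply hy
  have := congrArg (fun f => coeff f n) h4
  simpa [φ, ← map_mul, Ideal.Quotient.eq_zero_iff_mem] using this

open MvPolynomial

variable {K : Type*} [Field K]

/-- The generators of `chainIdeal`, the one with the last index first: each generator is monic in a
variable that does not occur in the generators before it. -/
noncomputable def chainList (K : Type*) [Field K] :
    {m : ℕ} → (Fin (m + 1) → ℕ) → List (MvPolynomial (Fin (m + 1)) K)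
  | 0, _ => []
  | _ + 1, δ => (chainList K (fun i => δ i.succ)).map (rename Fin.succ) ++
      [X 0 ^ δ 0 * (X 0 - X 1)]

theorem mem_chainList_iff {m : ℕ} (δ : Fin (m + 1) → ℕ) (f : MvPolynomial (Fin (m + 1)) K) :
    f ∈ chainList K δ ↔
      ∃ i : Fin m, X i.castSucc ^ δ i.castSucc * (X i.castSucc - X i.succ) = f := by
  induction m with
  | zero => simp [chainList]
  | succ m ih =>
    rw [Fin.exists_fin_succ]
    simp only [chainList, List.mem_append, List.mem_map, ih, List.mem_singleton]
    rw [or_comm]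
    refine or_congr ?_ ?_
    · simp [eq_comm]
    · constructor
      · rintro ⟨_, ⟨i, rfl⟩, rfl⟩
        exact ⟨i, by simp⟩
      · rintro ⟨i, rfl⟩
        exact ⟨_, ⟨i, rfl⟩, by simp⟩

theorem ofList_chainList {m : ℕ} (δ : Fin (m + 1) → ℕ) :
    Ideal.ofList (chainList K δ) = chainIdeal K δ := by
  rw [Ideal.ofList, chainIdeal]
  congr 1
  ext f
  exact mem_chainList_iff δ f

theorem finSuccEquiv_symm_C {m : ℕ} (q : MvPolynomial (Fin m) K) :
    (finSuccEquiv K m).symm (Polynomial.C q) = rename Fin.succ q := by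
  rw [AlgEquiv.symm_apply_eq, finSuccEquiv_apply]
  change _ = eval₂Hom _ _ (rename Fin.succ q)
  rw [eval₂Hom_rename]
  induction q using MvPolynomial.induction_on <;> simp_all

theorem chainList_succ {m : ℕ} (δ : Fin (m + 2) → ℕ) : chainList K δ =
    ((chainList K (fun i => δ i.succ)).map Polynomial.C ++
      [Polynomial.X ^ δ 0 * (Polynomial.X - Polynomial.C (X 0))]).map
        (finSuccEquiv K (m + 1)).symm.toRingEquiv := by
  have h0 : (finSuccEquiv K (m + 1)).symm Polynomial.X = X 0 := by
    rw [AlgEquiv.symm_apply_eq, finSuccEquiv_X_zero]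
  simp only [chainList, List.map_append, List.map_map, List.map_singleton]
  congr 2
  · ext1 q
    exact (finSuccEquiv_symm_C q).symm
  · simp [finSuccEquiv_symm_C, h0]

theorem mem_chainIdeal_succ_iff {m : ℕ} (δ : Fin (m + 2) → ℕ)
    (p : MvPolynomial (Fin (m + 2)) K) : p ∈ chainIdeal K δ ↔ finSuccEquiv K (m + 1) p ∈
      (chainIdeal K (fun i => δ i.succ)).map Polynomial.C ⊔
        Ideal.span {Polynomial.X ^ δ 0 * (Polynomial.X - Polynomial.C (X 0))} := by
  rw [← ofList_chainList, chainList_succ, ← ofList_chainList, Ideal.map_ofList,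
    ← Ideal.ofList_singleton, ← Ideal.ofList_append]
  set L := (chainList K (fun i => δ i.succ)).map Polynomial.C ++
    [Polynomial.X ^ δ 0 * (Polynomial.X - Polynomial.C (X 0))]
  have h := Ideal.map_ofList ((finSuccEquiv K (m + 1)).symm.toRingEquiv :
    Polynomial (MvPolynomial (Fin (m + 1)) K) →+* MvPolynomial (Fin (m + 2)) K) L
  have h' : Ideal.ofList (L.map (finSuccEquiv K (m + 1)).symm.toRingEquiv) =
      (Ideal.ofList L).map (finSuccEquiv K (m + 1)).symm.toRingEquiv := h.symm
  rw [h', Ideal.mem_map_of_equiv]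
  constructor
  · rintro ⟨x, hx, rfl⟩
    simpa using hx
  · exact fun h => ⟨_, h, by simp⟩

theorem isWeaklyRegular_chainList {m : ℕ} (δ : Fin (m + 1) → ℕ) :
    IsWeaklyRegular (MvPolynomial (Fin (m + 1)) K) (chainList K δ) := by
  induction m with
  | zero => exact IsWeaklyRegular.nil _ _
  | succ m ih =>
    rw [chainList_succ]
    exact isWeaklyRegular_map_ringEquiv _ (isWeaklyRegular_map_C_append_monic (ih _)
      ((Polynomial.monic_X_pow _).mul (Polynomial.monic_X_sub_C _)))

/-- The last variable is a nonzerodivisor modulo the chain ideal, since the other variables are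
adjoined to `K[x_m]` one after the other as roots of monic polynomials. -/
theorem mem_chainIdeal_of_X_last_mul_mem {m : ℕ} (δ : Fin (m + 1) → ℕ)
    {p : MvPolynomial (Fin (m + 1)) K} (hp : X (Fin.last m) * p ∈ chainIdeal K δ) :
    p ∈ chainIdeal K δ := by
  induction m with
  | zero =>
    have h0 : chainIdeal K δ = ⊥ := by
      rw [← ofList_chainList]
      exact Ideal.ofList_nil
    rw [h0, Ideal.mem_bot] at hp ⊢
    exact (mul_eq_zero.mp hp).resolve_left (X_ne_zero _)
  | succ m ih =>
    rw [mem_chainIdeal_succ_iff] at hp ⊢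
    rw [map_mul, ← Fin.succ_last, finSuccEquiv_X_succ] at hp
    exact mem_of_C_mul_mem (fun b hb => ih _ hb)
      ((Polynomial.monic_X_pow _).mul (Polynomial.monic_X_sub_C _)) hp

theorem mem_chainIdeal_of_X_last_pow_mul_mem {m : ℕ} (δ : Fin (m + 1) → ℕ) (n : ℕ)
    {p : MvPolynomial (Fin (m + 1)) K} (hp : X (Fin.last m) ^ n * p ∈ chainIdeal K δ) :
    p ∈ chainIdeal K δ := by
  induction n with
  | zero => simpa using hp
  | succ n ih =>
    rw [pow_succ', mul_assoc] at hp
    exact ih (mem_chainIdeal_of_X_last_mul_mem δ hp)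

/-- The product closing the cycle is a nonzerodivisor modulo the other generators. On the
annihilator of `x_m - a * x_0`, the relation `x_0 ^ e * (x_0 - x_m) = 0` turns into
`(1 - a) * x_m ^ (e + 1) = 0`. -/
theorem mem_chainIdeal_of_last_mul_mem {m : ℕ} (δ : Fin (m + 1) → ℕ) {a : K} (ha : a ≠ 1)
    {p : MvPolynomial (Fin (m + 1)) K} (hp : X (Fin.last m) ^ δ (Fin.last m) *
      (X (Fin.last m) - C a * X 0) * p ∈ chainIdeal K δ) : p ∈ chainIdeal K δ := by
  rw [mul_assoc] at hp
  replace hp := mem_chainIdeal_of_X_last_pow_mul_mem δ _ hp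
  have h0 := X_zero_pow_mul_sub_mem_chainIdeal (K := K) δ (Fin.last m)
  set e := ∑ j ∈ Finset.Iio (Fin.last m), δ j
  obtain ⟨u, hu⟩ := sub_dvd_pow_sub_pow (X (Fin.last m)) (C a * X 0) e
  have h1 : X (Fin.last m) ^ (e + 1) * (C (1 - a) * p) ∈ chainIdeal K δ := by
    have h2 : X (Fin.last m) ^ (e + 1) * (C (1 - a) * p) =
        (u * C (1 - a) * X (Fin.last m) + (C a * X 0) ^ e) * ((X (Fin.last m) - C a * X 0) * p) +
          C a ^ (e + 1) * p * (X 0 ^ e * (X 0 - X (Fin.last m))) := by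
      rw [C_sub, C_1]
      linear_combination ((1 - C a) * X (Fin.last m) * p) * hu
    rw [h2]
    exact add_mem (Ideal.mul_mem_left _ _ hp) (Ideal.mul_mem_left _ _ h0)
  have h3 := Ideal.mul_mem_left _ (C (1 - a)⁻¹) (mem_chainIdeal_of_X_last_pow_mul_mem δ _ h1)
  rwa [← mul_assoc, ← C_mul, inv_mul_cancel₀ (sub_ne_zero.mpr ha.symm), C_1, one_mul] at h3

/-- The generators of the product ideal, in the order in which they form a regular sequence. -/
noncomputable def productList {m : ℕ} (d : Fin (m + 1) → ℕ) (a : K) :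
    List (MvPolynomial (Fin (m + 1)) K) :=
  chainList K (cyclicExponent d) ++
    [X (Fin.last m) ^ cyclicExponent d (Fin.last m) * (X (Fin.last m) - C a * X 0)]

theorem isWeaklyRegular_productList {m : ℕ} (d : Fin (m + 1) → ℕ) {a : K} (ha : a ≠ 1) :
    IsWeaklyRegular (MvPolynomial (Fin (m + 1)) K) (productList d a) := by
  rw [productList, isWeaklyRegular_append_singleton_iff, ofList_chainList]
  exact ⟨isWeaklyRegular_chainList _, fun p hp => mem_chainIdeal_of_last_mul_mem _ ha hp⟩

theorem ofList_productList {m : ℕ} (d : Fin (m + 1) → ℕ) (a : K) :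
    Ideal.ofList (productList d a) = linearProductIdeal m d a := by
  rw [productList, Ideal.ofList_append, ofList_chainList, Ideal.ofList_singleton,
    linearProductIdeal_eq]

end Regularity

/-! ### Hilbert series -/

section HilbertSeries

open MvPolynomial RingTheory.Sequence

variable {K σ : Type*} [Field K]

instance finiteDimensional_gradedPiece [Finite σ] (J : Ideal (MvPolynomial σ K)) (k : ℕ) :
    FiniteDimensional K (gradedPiece J k) := by
  rw [gradedPiece, ← Submodule.fg_iff_finiteDimensional]
  exact (homogeneousSubmodule_fg σ K k).map _

/-- The Hilbert series of `K[x_σ] / J`. -/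
noncomputable def hilbertSeries (J : Ideal (MvPolynomial σ K)) : PowerSeries ℤ :=
  PowerSeries.mk fun k => (Module.finrank K (gradedPiece J k) : ℤ)

theorem homogeneousComponent_mul_of_isHomogeneous {f : MvPolynomial σ K} {e : ℕ}
    (hf : f.IsHomogeneous e) (q : MvPolynomial σ K) (k : ℕ) :
    homogeneousComponent k (f * q) =
      if e ≤ k then f * homogeneousComponent (k - e) q else 0 := by
  have h : ∀ i, homogeneousComponent k (f * homogeneousComponent i q) =
      if e + i = k then f * homogeneousComponent i q else 0 := fun i => by
    rw [homogeneousComponent_of_mem (hf.mul (homogeneousComponent_isHomogeneous i q))]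
    simp [eq_comm]
  conv_lhs => rw [← sum_homogeneousComponent q, Finset.mul_sum, map_sum]
  simp_rw [h]
  split_ifs with hek
  · rw [Finset.sum_eq_single (k - e)]
    · rw [if_pos (by omega)]
    · intro i _ hi
      rw [if_neg (by omega)]
    · intro hi
      rw [if_pos (by omega), homogeneousComponent_eq_zero, mul_zero]
      rw [Finset.mem_range] at hi
      omega
  · exact Finset.sum_eq_zero fun i _ => if_neg (by omega)

section

attribute [local instance] MvPolynomial.gradedAlgebra

theorem homogeneousComponent_mem_ofList {rs : List (MvPolynomial σ K)}
    (h : ∀ f ∈ rs, ∃ e : ℕ, f.IsHomogeneous e) {p : MvPolynomial σ K} (hp : p ∈ Ideal.ofList rs)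
    (k : ℕ) : homogeneousComponent k p ∈ Ideal.ofList rs :=
  homogeneousComponent_mem_of_mem (Ideal.homogeneous_span _ _ h) hp k

end

/-- Dividing by a homogeneous nonzerodivisor of degree `e` multiplies the Hilbert series by
`1 - T ^ e`. -/
theorem hilbertSeries_sup_span_singleton [Finite σ] {J : Ideal (MvPolynomial σ K)}
    (hJ : ∀ p ∈ J, ∀ k, homogeneousComponent k p ∈ J) {f : MvPolynomial σ K} {e : ℕ}
    (hf : f.IsHomogeneous e) (hreg : ∀ p, f * p ∈ J → p ∈ J) :
    hilbertSeries (J ⊔ Ideal.span {f}) = (1 - PowerSeries.X ^ e) * hilbertSeries J := by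
  ext k
  rw [sub_mul, one_mul, map_sub, PowerSeries.coeff_X_pow_mul']
  simp only [hilbertSeries, PowerSeries.coeff_mk]
  have hle : J ≤ J ⊔ Ideal.span {f} := le_sup_left
  let π : (MvPolynomial σ K ⧸ J) →ₐ[K] (MvPolynomial σ K ⧸ (J ⊔ Ideal.span {f})) :=
    Ideal.Quotient.factorₐ K hle
  have hπ : ∀ y ∈ gradedPiece J k, π.toLinearMap y ∈ gradedPiece (J ⊔ Ideal.span {f}) k := by
    rintro _ ⟨p, hp, rfl⟩
    exact ⟨p, hp, rfl⟩
  let h := π.toLinearMap.restrict hπ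
  have hsurj : LinearMap.range h = ⊤ := by
    rw [LinearMap.range_eq_top]
    rintro ⟨_, ⟨p, hp, rfl⟩⟩
    exact ⟨⟨_, ⟨p, hp, rfl⟩⟩, rfl⟩
  have hker : ∀ p : MvPolynomial σ K, p.IsHomogeneous k → p ∈ J ⊔ Ideal.span {f} →
      ∃ q, p - (if e ≤ k then f * homogeneousComponent (k - e) q else 0) ∈ J := by
    intro p hp hpJ
    obtain ⟨c, hc, z, hz, rfl⟩ := Submodule.mem_sup.mp hpJ
    obtain ⟨q, rfl⟩ := Ideal.mem_span_singleton.mp hz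
    refine ⟨q, ?_⟩
    rw [← homogeneousComponent_mul_of_isHomogeneous hf]
    conv => enter [2, 1]; rw [← homogeneousComponent_eq_self hp]
    rw [← map_sub, add_sub_cancel_right]
    exact hJ c hc k
  have hrank := LinearMap.finrank_range_add_finrank_ker h
  rw [hsurj, finrank_top] at hrank
  have hkerrank : Module.finrank K (LinearMap.ker h) =
      if e ≤ k then Module.finrank K (gradedPiece J (k - e)) else 0 := by
    rw [((LinearMap.ker h).equivMapOfInjective _
      (gradedPiece J k).injective_subtype).finrank_eq]
    split_ifs with hek
    · have hinj : Function.Injective (LinearMap.mulLeft K (Ideal.Quotient.mk J f)) := by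
        rw [injective_iff_map_eq_zero]
        intro y hy
        obtain ⟨p, rfl⟩ := Ideal.Quotient.mk_surjective y
        rw [LinearMap.mulLeft_apply, ← map_mul, Ideal.Quotient.eq_zero_iff_mem] at hy
        exact Ideal.Quotient.eq_zero_iff_mem.mpr (hreg p hy)
      have hmap : (LinearMap.ker h).map (gradedPiece J k).subtype = (gradedPiece J (k - e)).map
          (LinearMap.mulLeft K (Ideal.Quotient.mk J f)) := by
        ext y
        constructor
        · rintro ⟨⟨_, ⟨p, hp, rfl⟩⟩, hy, rfl⟩
          obtain ⟨q, hq⟩ := hker p hp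
            (Ideal.Quotient.eq_zero_iff_mem.mp (congrArg Subtype.val (LinearMap.mem_ker.mp hy)))
          rw [if_pos hek] at hq
          refine ⟨_, ⟨homogeneousComponent (k - e) q,
            homogeneousComponent_isHomogeneous _ _, rfl⟩, ?_⟩
          exact (map_mul _ _ _).symm.trans (Ideal.Quotient.eq.mpr hq).symm
        · rintro ⟨_, ⟨q, hq, rfl⟩, rfl⟩
          have hfq : (f * q).IsHomogeneous k := by
            have := hf.mul hq
            rwa [Nat.add_sub_cancel' hek] at this
          refine ⟨⟨_, ⟨f * q, hfq, rfl⟩⟩, ?_, map_mul (Ideal.Quotient.mk J) f q⟩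
          exact LinearMap.mem_ker.mpr (Subtype.ext (Ideal.Quotient.eq_zero_iff_mem.mpr
            (Ideal.mem_sup_right (Ideal.mul_mem_right _ _ (Ideal.subset_span rfl)))))
      rw [hmap, ← ((gradedPiece J (k - e)).equivMapOfInjective _ hinj).finrank_eq]
    · have hbot : LinearMap.ker h = ⊥ := by
        rw [eq_bot_iff]
        rintro ⟨_, ⟨p, hp, rfl⟩⟩ hy
        obtain ⟨q, hq⟩ := hker p hp
          (Ideal.Quotient.eq_zero_iff_mem.mp (congrArg Subtype.val (LinearMap.mem_ker.mp hy)))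
        rw [if_neg hek, sub_zero] at hq
        exact Subtype.ext (Ideal.Quotient.eq_zero_iff_mem.mpr hq)
      rw [hbot, Submodule.map_bot, finrank_bot]
  rw [hkerrank] at hrank
  split_ifs at hrank ⊢ <;> omega

theorem hilbertSeries_ofList [Finite σ] (L : List (MvPolynomial σ K × ℕ))
    (hL : ∀ x ∈ L, x.1.IsHomogeneous x.2)
    (hreg : IsWeaklyRegular (MvPolynomial σ K) (L.map Prod.fst)) :
    hilbertSeries (Ideal.ofList (L.map Prod.fst)) =
      (L.map fun x => (1 - PowerSeries.X ^ x.2 : PowerSeries ℤ)).prod *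
        hilbertSeries (⊥ : Ideal (MvPolynomial σ K)) := by
  induction L using List.reverseRecOn with
  | nil => simp
  | append_singleton L x ih =>
    rw [List.map_append, List.map_singleton, isWeaklyRegular_append_singleton_iff] at hreg
    rw [List.map_append, List.map_singleton, Ideal.ofList_append, Ideal.ofList_singleton,
      hilbertSeries_sup_span_singleton _ (hL x (by simp)) hreg.2,
      ih (fun y hy => hL y (by simp [hy])) hreg.1]
    · simp only [List.map_append, List.map_singleton, List.prod_append, List.prod_singleton]
      ring
    · intro p hp k
      refine homogeneousComponent_mem_ofList ?_ hp k
      intro f hf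
      obtain ⟨y, hy, rfl⟩ := List.mem_map.mp hf
      exact ⟨y.2, hL y (by simp [hy])⟩

theorem one_sub_pow_mul_hilbertSeries_bot (m : ℕ) :
    (1 - PowerSeries.X) ^ (m + 1) *
      hilbertSeries (⊥ : Ideal (MvPolynomial (Fin (m + 1)) K)) = 1 := by
  have h : hilbertSeries (⊥ : Ideal (MvPolynomial (Fin (m + 1)) K)) =
      (PowerSeries.invOneSubPow ℤ (m + 1)).val := by
    rw [PowerSeries.invOneSubPow_val_succ_eq_mk_add_choose, hilbertSeries]
    congr 1
    ext1 k
    congr 1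
    have hinj : Function.Injective
        (Ideal.Quotient.mkₐ K (⊥ : Ideal (MvPolynomial (Fin (m + 1)) K))).toLinearMap := by
      intro x y hxy
      have := Ideal.Quotient.eq.mp hxy
      rwa [Ideal.mem_bot, sub_eq_zero] at this
    rw [gradedPiece, ← (Submodule.equivMapOfInjective _ hinj _).finrank_eq,
      homogeneousSubmodule_eq_finsupp_supported]
    change Module.finrank K (restrictSupport K {d : Fin (m + 1) →₀ ℕ | d.degree = k}) = _
    rw [Module.finrank_eq_nat_card_basis (basisRestrictSupport K _)]
    have hset : {d : Fin (m + 1) →₀ ℕ | d.degree = k} =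
        ((Finset.univ.finsuppAntidiag k : Finset (Fin (m + 1) →₀ ℕ)) : Set _) := by
      ext d
      simp [Finset.mem_finsuppAntidiag, Finsupp.degree_eq_sum]
    rw [hset, Nat.card_coe_set_eq, Set.ncard_coe_finset, Finset.card_finsuppAntidiag_nat_eq_choose,
      Finset.card_univ, Fintype.card_fin, show m + 1 + k - 1 = m + k by omega,
      ← Nat.choose_symm_add]
  rw [h]
  exact (PowerSeries.invOneSubPow ℤ (m + 1)).inv_val

/-- The product of the polynomials `1 + X + ⋯ + X ^ δ_i` has degree at most `D = ∑ δ_i`, and its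
coefficients are symmetric about `D / 2`. -/
theorem reflect_geom_prod {ι : Type*} (s : Finset ι) (δ : ι → ℕ) :
    Polynomial.reflect (∑ i ∈ s, δ i)
      (∏ i ∈ s, ∑ j ∈ Finset.range (δ i + 1), (Polynomial.X : Polynomial ℤ) ^ j) =
        ∏ i ∈ s, ∑ j ∈ Finset.range (δ i + 1), (Polynomial.X : Polynomial ℤ) ^ j ∧
    (∏ i ∈ s, ∑ j ∈ Finset.range (δ i + 1), (Polynomial.X : Polynomial ℤ) ^ j).natDegree ≤
      ∑ i ∈ s, δ i := by
  classical
  have hdeg : ∀ n,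
      (∑ j ∈ Finset.range (n + 1), (Polynomial.X : Polynomial ℤ) ^ j).natDegree ≤ n := by
    intro n
    refine Polynomial.natDegree_sum_le_of_forall_le _ _ fun j hj => ?_
    rw [Polynomial.natDegree_X_pow]
    exact Nat.lt_succ_iff.mp (Finset.mem_range.mp hj)
  have hrefl : ∀ n, Polynomial.reflect n
      (∑ j ∈ Finset.range (n + 1), (Polynomial.X : Polynomial ℤ) ^ j) =
      ∑ j ∈ Finset.range (n + 1), (Polynomial.X : Polynomial ℤ) ^ j := by
    intro n
    ext k
    simp only [Polynomial.coeff_reflect, Polynomial.finsetSum_coeff, Polynomial.coeff_X_pow,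
      Finset.sum_ite_eq, Finset.mem_range]
    rcases le_or_gt k n with hk | hk
    · rw [Polynomial.revAt_le hk, if_pos (by omega), if_pos (by omega)]
    · rw [Polynomial.revAt_eq_self_of_lt hk]
  induction s using Finset.induction_on with
  | empty => simp
  | insert i s hi ih =>
    rw [Finset.sum_insert hi, Finset.prod_insert hi, Polynomial.reflect_mul _ _ (hdeg _) ih.2,
      hrefl, ih.1]
    exact ⟨rfl, Polynomial.natDegree_mul_le.trans (add_le_add (hdeg _) ih.2)⟩

theorem exists_chainList_degrees {m : ℕ} (δ : Fin (m + 1) → ℕ) :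
    ∃ L : List (MvPolynomial (Fin (m + 1)) K × ℕ), L.map Prod.fst = chainList K δ ∧
      (∀ x ∈ L, x.1.IsHomogeneous x.2) ∧
        (L.map fun x => (1 - PowerSeries.X ^ x.2 : PowerSeries ℤ)).prod =
          ∏ i : Fin m, (1 - PowerSeries.X ^ (δ i.castSucc + 1)) := by
  induction m with
  | zero => exact ⟨[], by simp [chainList]⟩
  | succ m ih =>
    obtain ⟨L, h1, h2, h3⟩ := ih fun i => δ i.succ
    refine ⟨L.map (fun x => (rename Fin.succ x.1, x.2)) ++
      [(X 0 ^ δ 0 * (X 0 - X 1), δ 0 + 1)], ?_, ?_, ?_⟩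
    · rw [chainList, ← h1]
      simp
    · intro x hx
      rw [List.mem_append, List.mem_map, List.mem_singleton] at hx
      rcases hx with ⟨y, hy, rfl⟩ | rfl
      · exact (h2 y hy).rename_isHomogeneous
      · exact (isHomogeneous_X_pow _ _).mul ((isHomogeneous_X _ _).sub (isHomogeneous_X _ _))
    · rw [Fin.prod_univ_succ, List.map_append, List.prod_append, List.map_singleton,
        List.prod_singleton, List.map_map, Fin.castSucc_zero,
        mul_comm (1 - (PowerSeries.X : PowerSeries ℤ) ^ (δ 0 + 1))]
      exact congrArg (· * _) h3

theorem hilbertSeries_linearProductIdeal {m : ℕ} (d : Fin (m + 1) → ℕ) {a : K} (ha : a ≠ 1) :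
    hilbertSeries (linearProductIdeal m d a) =
      ((∏ i, ∑ j ∈ Finset.range (cyclicExponent d i + 1), (Polynomial.X : Polynomial ℤ) ^ j :
        Polynomial ℤ) : PowerSeries ℤ) := by
  obtain ⟨L, h1, h2, h3⟩ := exists_chainList_degrees (K := K) (cyclicExponent d)
  have h := hilbertSeries_ofList (L ++ [(X (Fin.last m) ^ cyclicExponent d (Fin.last m) *
    (X (Fin.last m) - C a * X 0), cyclicExponent d (Fin.last m) + 1)]) ?_ ?_
  · have hL : (L ++ [(X (Fin.last m) ^ cyclicExponent d (Fin.last m) *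
        (X (Fin.last m) - C a * X 0), cyclicExponent d (Fin.last m) + 1)]).map Prod.fst =
        productList d a := by
      simp [productList, h1]
    rw [hL, ofList_productList] at h
    rw [h, List.map_append, List.prod_append, h3, List.map_singleton, List.prod_singleton,
      ← Fin.prod_univ_castSucc (fun i => (1 - PowerSeries.X ^ (cyclicExponent d i + 1) :
        PowerSeries ℤ))]
    have hgeom : ∀ i, (1 - PowerSeries.X ^ (cyclicExponent d i + 1) : PowerSeries ℤ) =
        (1 - PowerSeries.X) *
          ∑ j ∈ Finset.range (cyclicExponent d i + 1), PowerSeries.X ^ j :=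
      fun i => (mul_neg_geom_sum _ _).symm
    simp_rw [hgeom]
    rw [Finset.prod_mul_distrib, Finset.prod_const, Finset.card_univ, Fintype.card_fin,
      mul_right_comm, one_sub_pow_mul_hilbertSeries_bot, one_mul]
    rw [← Polynomial.coeToPowerSeries.ringHom_apply]
    simp only [map_prod, map_sum, map_pow, Polynomial.coeToPowerSeries.ringHom_apply,
      Polynomial.coe_X]
  · intro x hx
    rw [List.mem_append, List.mem_singleton] at hx
    rcases hx with hx | rfl
    · exact h2 x hx
    · exact (isHomogeneous_X_pow _ _).mul
        ((isHomogeneous_X _ _).sub (isHomogeneous_C_mul_X _ _))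
  · simpa [productList, h1] using isWeaklyRegular_productList d ha

end HilbertSeries

/-! ### The strong Lefschetz property -/

section StrongLefschetz

open MvPolynomial

/-- A Hilbert function that is symmetric about `D / 2` and vanishes above `D` reduces the strong
Lefschetz property to surjectivity from degree `k` to degree `D - k`. -/
theorem isStrongLefschetzElement_of_surjective {K σ : Type*} [Field K] [Finite σ]
    {I : Ideal (MvPolynomial σ K)} {D : ℕ}
    (hsymm : ∀ k ≤ D, Module.finrank K (gradedPiece I (D - k)) = Module.finrank K (gradedPiece I k))
    (hvan : ∀ k, D < k → gradedPiece I k = ⊥) {l : MvPolynomial σ K} (hl : l.IsHomogeneous 1)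
    (hsurj : ∀ k, 2 * k ≤ D → ∀ p : MvPolynomial σ K, p.IsHomogeneous (D - k) →
      ∃ q : MvPolynomial σ K, q.IsHomogeneous k ∧ p - l ^ (D - 2 * k) * q ∈ I) :
    IsStrongLefschetzElement I (Ideal.Quotient.mk I l) := by
  refine ⟨⟨l, hl, rfl⟩, fun k s => ?_⟩
  have hhom : ∀ {q : MvPolynomial σ K} {j n N : ℕ}, q.IsHomogeneous j → n + j = N →
      (l ^ n * q).IsHomogeneous N := fun {q j n N} hq h => by
    have := (hl.pow n).mul hq
    rwa [one_mul, h] at this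
  by_cases hks : 2 * k + s ≤ D
  · left
    let φ : gradedPiece I k →ₗ[K] gradedPiece I (D - k) :=
      (LinearMap.mulLeft K (Ideal.Quotient.mk I l ^ (D - 2 * k))).restrict (by
        rintro _ ⟨q, hq, rfl⟩
        refine ⟨l ^ (D - 2 * k) * q, hhom hq (by omega), ?_⟩
        exact (map_mul (Ideal.Quotient.mk I) _ _).trans (by rw [map_pow]; rfl))
    have hφ : Function.Surjective φ := by
      rintro ⟨_, ⟨p, hp, rfl⟩⟩
      obtain ⟨q, hq, hpq⟩ := hsurj k (by omega) p hp
      refine ⟨⟨_, ⟨q, hq, rfl⟩⟩, Subtype.ext ?_⟩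
      have := Ideal.Quotient.eq.mpr hpq
      rw [map_mul, map_pow] at this
      exact this.symm
    have hφ' : Function.Injective φ :=
      (LinearMap.injective_iff_surjective_of_finrank_eq_finrank (hsymm k (by omega)).symm).mpr hφ
    intro y hy z hz hyz
    have h : φ ⟨y, hy⟩ = φ ⟨z, hz⟩ := by
      refine Subtype.ext ?_
      change Ideal.Quotient.mk I l ^ (D - 2 * k) * y = Ideal.Quotient.mk I l ^ (D - 2 * k) * z
      rw [show D - 2 * k = (D - 2 * k - s) + s by omega, pow_add, mul_assoc, mul_assoc]
      exact congrArg _ hyz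
    exact congrArg Subtype.val (hφ' h)
  · right
    rcases le_or_gt (k + s) D with hD | hD
    · rintro _ ⟨p, hp, rfl⟩
      obtain ⟨q, hq, hpq⟩ := hsurj (D - (k + s)) (by omega) p
        (by rw [Nat.sub_sub_self hD]; exact hp)
      rw [show D - 2 * (D - (k + s)) = s + (k - (D - (k + s))) by omega, pow_add, mul_assoc] at hpq
      refine ⟨_, ⟨l ^ (k - (D - (k + s))) * q, hhom hq (by omega), rfl⟩, ?_⟩
      have := Ideal.Quotient.eq.mpr hpq
      rw [map_mul, map_pow] at this
      exact this.symm
    · intro z hz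
      rw [hvan _ hD, SetLike.mem_coe, Submodule.mem_bot] at hz
      exact ⟨0, zero_mem _, by simp [hz]⟩

theorem finite_quotient_of_gradedPiece_eq_bot {K σ : Type*} [Field K] [Finite σ]
    {I : Ideal (MvPolynomial σ K)} {D : ℕ} (hvan : ∀ k, D < k → gradedPiece I k = ⊥) :
    Module.Finite K (MvPolynomial σ K ⧸ I) := by
  have h : (⨆ k ∈ Finset.range (D + 1), gradedPiece I k) = ⊤ := by
    rw [eq_top_iff]
    intro y _
    obtain ⟨p, rfl⟩ := Ideal.Quotient.mk_surjective y
    rw [← sum_homogeneousComponent p, map_sum]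
    refine sum_mem fun k _ => ?_
    have hmem : Ideal.Quotient.mk I (homogeneousComponent k p) ∈ gradedPiece I k :=
      ⟨_, homogeneousComponent_isHomogeneous k p, rfl⟩
    rcases le_or_gt k D with hk | hk
    · exact Submodule.mem_iSup_of_mem k (Submodule.mem_iSup_of_mem
        (Finset.mem_range.mpr (by omega)) hmem)
    · rw [hvan k hk, Submodule.mem_bot] at hmem
      rw [hmem]
      exact zero_mem _
  refine ⟨?_⟩
  rw [← h]
  exact Submodule.fg_biSup _ _ fun k _ => (homogeneousSubmodule_fg σ K k).map _

variable {K : Type*} [Field K] {m : ℕ}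

theorem finrank_gradedPiece_linearProductIdeal (d : Fin (m + 1) → ℕ) {a : K} (ha : a ≠ 1) (k : ℕ) :
    (Module.finrank K (gradedPiece (linearProductIdeal m d a) k) : ℤ) =
      (∏ i, ∑ j ∈ Finset.range (cyclicExponent d i + 1), (Polynomial.X : Polynomial ℤ) ^ j).coeff
        k := by
  have h := congrArg (PowerSeries.coeff k) (hilbertSeries_linearProductIdeal d ha)
  rwa [hilbertSeries, PowerSeries.coeff_mk, Polynomial.coeff_coe] at h

theorem finrank_gradedPiece_sub (d : Fin (m + 1) → ℕ) {a : K} (ha : a ≠ 1) {k : ℕ}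
    (hk : k ≤ ∑ i, cyclicExponent d i) :
    Module.finrank K (gradedPiece (linearProductIdeal m d a) (∑ i, cyclicExponent d i - k)) =
      Module.finrank K (gradedPiece (linearProductIdeal m d a) k) := by
  zify
  rw [finrank_gradedPiece_linearProductIdeal d ha, finrank_gradedPiece_linearProductIdeal d ha,
    ← Polynomial.revAt_le hk, ← Polynomial.coeff_reflect, (reflect_geom_prod _ _).1]

theorem gradedPiece_eq_bot (d : Fin (m + 1) → ℕ) {a : K} (ha : a ≠ 1) {k : ℕ}
    (hk : ∑ i, cyclicExponent d i < k) : gradedPiece (linearProductIdeal m d a) k = ⊥ := by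
  rw [← Submodule.finrank_eq_zero (R := K)]
  have h := finrank_gradedPiece_linearProductIdeal d ha k
  rw [Polynomial.coeff_eq_zero_of_natDegree_lt
    (lt_of_le_of_lt (reflect_geom_prod Finset.univ (cyclicExponent d)).2 hk)] at h
  exact_mod_cast h

theorem linearProductIdeal_ne_top (d : Fin (m + 1) → ℕ) (a : K) :
    linearProductIdeal m d a ≠ ⊤ := by
  have h : linearProductIdeal m d a ≤ RingHom.ker (constantCoeff (σ := Fin (m + 1)) (R := K)) := by
    rw [linearProductIdeal, Ideal.span_le, Set.insert_subset_iff]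
    refine ⟨by simp, ?_⟩
    rintro _ ⟨i, rfl⟩
    simp
  intro htop
  rw [htop] at h
  exact RingHom.ker_ne_top _ (top_le_iff.mp h)

theorem isGradedCompleteIntersection_linearProductIdeal (d : Fin (m + 1) → ℕ) {a : K}
    (ha : a ≠ 1) : IsGradedCompleteIntersection (linearProductIdeal m d a) := by
  refine ⟨productList d a, ?_, ⟨isWeaklyRegular_productList d ha, ?_⟩,
    (ofList_productList d a).symm⟩
  · intro f hf
    rw [productList, List.mem_append, mem_chainList_iff, List.mem_singleton] at hf
    rcases hf with ⟨i, rfl⟩ | rfl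
    · exact ⟨_, (isHomogeneous_X_pow _ _).mul ((isHomogeneous_X _ _).sub (isHomogeneous_X _ _))⟩
    · exact ⟨_, (isHomogeneous_X_pow _ _).mul
        ((isHomogeneous_X _ _).sub (isHomogeneous_C_mul_X _ _))⟩
  · rw [ofList_productList, smul_eq_mul, Ideal.mul_top]
    exact (linearProductIdeal_ne_top d a).symm

theorem hasStrongLefschetzProperty_linearProductIdeal [CharZero K] (d : Fin (m + 1) → ℕ)
    (hd : ∀ i, 0 < d i) {a : K} (ha : a ≠ 1) :
    HasStrongLefschetzProperty (linearProductIdeal m d a) := by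
  set I := linearProductIdeal m d a
  set D := ∑ i, cyclicExponent d i with hD
  have hfin : ∀ k, 2 * k ≤ D → {t : K | ¬ ∀ p : MvPolynomial (Fin (m + 1)) K,
      p.IsHomogeneous (D - k) → ∃ q : MvPolynomial (Fin (m + 1)) K, q.IsHomogeneous k ∧
        p - (∑ i, C (t ^ chainWeight i) * X i) ^ (D - 2 * k) * q ∈ I}.Finite := by
    intro k hk
    refine finite_setOf_not_surjective_of_degeneration chainWeight I
      (IsLeadingExponent (cyclicExponent d)) ?_ ?_
    · intro b hb hlead
      obtain ⟨c, b', h1, h2⟩ := exists_monomial_sub_mem_linearProductIdeal d a hlead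
      exact ⟨c, b', h1.trans hb, h2⟩
    · intro p hp
      exact exists_sub_pow_mul_mem_restrictSupport _ (cyclicExponent_pos hd)
        (by omega) (by omega) hp
  obtain ⟨t, ht⟩ := (Set.Finite.biUnion (Set.finite_Iic (D / 2))
    fun k hk => hfin k (by have := Set.mem_Iic.mp hk; omega)).exists_notMem
  refine ⟨_, isStrongLefschetzElement_of_surjective (D := D)
    (l := ∑ i, C (t ^ chainWeight i) * X i) (fun k hk => finrank_gradedPiece_sub d ha hk)
    (fun k hk => gradedPiece_eq_bot d ha hk)
    (IsHomogeneous.sum _ _ _ fun i _ => isHomogeneous_C_mul_X _ i) fun k hk => ?_⟩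
  by_contra hcon
  exact ht (Set.mem_biUnion (Set.mem_Iic.mpr (by omega : k ≤ D / 2)) hcon)

end StrongLefschetz

theorem theorem1p2 {K : Type*} [Field K] [CharZero K] (m : ℕ) (d : Fin (m + 1) → ℕ)
    (hd : ∀ i, 0 < d i) (a : K) (ha : a ≠ 1) :
    IsArtinianRing (MvPolynomial (Fin (m + 1)) K ⧸ linearProductIdeal m d a) ∧
      IsGradedCompleteIntersection (linearProductIdeal m d a) ∧
      HasStrongLefschetzProperty (linearProductIdeal m d a) := by
  have := finite_quotient_of_gradedPiece_eq_bot fun k hk => gradedPiece_eq_bot d ha (k := k) hk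
  exact ⟨IsArtinianRing.of_finite K _, isGradedCompleteIntersection_linearProductIdeal d ha,
    hasStrongLefschetzProperty_linearProductIdeal d hd ha⟩
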